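/- Let $\psi=\Gamma'/\Gamma$ be the digamma function, $\gamma$ Euler's constant and $\zeta$ the Riemann zeta function. For $z\in\mathbb C\setminus\{-1,-2,-3,\dots\}$ put $$H_z=\psi(z+1)+\gamma,\qquad H_z^{(r)}=\zeta(r)+\frac{(-1)^{r-1}}{(r-1)!}\,\psi^{(r-1)}(z+1)\quad(r=2,3),$$ where $\psi^{(r-1)}$ is the $(r-1)$-th derivative of $\psi$, so that for a non-negative integer $z=n$ these are $\sum_{j=1}^n 1/j$ and $\sum_{j=1}^n 1/j^r$; and put $$\binom{u}{v}=\frac{\Gamma(u+1)}{\Gamma(v+1)\Gamma(u-v+1)}.$$ Then for every $z\in\mathbb C\setminus\{-1,-2,-3,\dots\}$ with $\operatorname{Re} z>-3$ (the half-plane in which the series converges), the following series converges absolutely and $$\begin{aligned}\sum_{n=1}^\infty\frac{H_{n+z}}{n(n+1)(n+2)(n+3)\binom{n+z}{n}}={}&\left(\frac{1}{12}z(z+1)(z+2)H_z-\frac{z(z+2)}{4}-\frac16\right)\left(H_z^{(2)}-\zeta(2)\right)\\&+\frac16z(z+1)(z+2)\left(H_z^{(3)}-\zeta(3)\right)+\left(\frac{z^2}{12}+\frac{5z}{24}+\frac1{18}\right)H_z-\frac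 z6-\frac5{24}.\end{aligned}$$ In particular, $$\sum_{n=1}^\infty\frac{H_n}{n(n+1)(n+2)(n+3)}=\frac{\pi^2}{36}-\frac5{24}.$$ -/

import Mathlib

/-- The polygamma function `ψ^{(r)}`, the `r`-th derivative of the digamma function. -/
noncomputable def polygamma (r : ℕ) (z : ℂ) : ℂ :=
  iteratedDeriv r Complex.digamma z

/-- The harmonic number `H_z = ψ(z + 1) + γ` of complex argument. -/
noncomputable def complexHarmonic (z : ℂ) : ℂ :=
  Complex.digamma (z + 1) + (Real.eulerMascheroniConstant : ℂ)

/-- The generalized harmonic number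
`H_z^{(r)} = ζ(r) + (-1)^{r-1} / (r-1)! * ψ^{(r-1)}(z + 1)` of complex argument and integer
order `r ≥ 2` (for order one use `complexHarmonic`). -/
noncomputable def complexGenHarmonic (r : ℕ) (z : ℂ) : ℂ :=
  riemannZeta (r : ℂ) +
    (-1 : ℂ) ^ (r - 1) / ((r - 1).factorial : ℂ) * polygamma (r - 1) (z + 1)

/-- The generalized binomial coefficient `Γ(u + 1) / (Γ(v + 1) Γ(u - v + 1))`. -/
noncomputable def complexBinom (u v : ℂ) : ℂ :=
  Complex.Gamma (u + 1) / (Complex.Gamma (v + 1) * Complex.Gamma (u - v + 1))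

/-!
Write `a_n(z)` for the reciprocal of `binom (n + z) n` and put
`S(z) = ∑ a_n(z) / (n (n + 1) (n + 2) (n + 3))`. The logarithmic derivative of `a_n` is
`ψ(z + 1) - ψ(n + z + 1) = H_z - H_{n + z}`, so the sum sought is `H_z S(z) - S'(z)`, provided
that `S` may be differentiated termwise. It may: comparing `a_n(z)` with `a_n(σ)` for a real `σ`
slightly above `-3` and using Euler's limit formula for `Γ(σ)`, one gets
`a_n(z) = O(n ^ (-σ))` locally uniformly (`exists_norm_invBinom_le_nhds`), hence locally uniform
convergence on the whole domain.

It remains to show that `S(z) = -Q(z) ψ'(z + 1) / 12 + p(z)` with `Q(z) = z (z + 1) (z + 2)` and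
`p(z) = z² / 12 + 5 z / 24 + 1 / 18` (`baseSum_eq_baseClosed`); differentiating this gives the
formula. A telescoping sum shows `(z + 3) S(z) - z S(z + 1) = 1 / (6 (z + 1))`
(`baseSum_functional_equation`). The right-hand side of the closed form satisfies the same
equation, so the difference of the two sides, divided by `Q`, is invariant under `z ↦ z + 1`. It
tends to zero along `z + n`, because `S` is bounded on `0 ≤ re z`, because `p / Q → 0`, and because
`ψ'(w) = ∑ 1 / (w + k) ^ 2` (`hasSum_deriv_digamma`) forces `ψ'(w + n) → 0`. At `z = 0`, where `Q`
vanishes, the functional equation gives the value directly.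

The trigamma series is obtained from Euler's product, written on the right half-plane as
`Γ(w) = exp (∑ (w log ((k + 2) / (k + 1)) - log (1 + w / (k + 1)))) / w` and differentiated twice.
At `w = 1` it gives `ψ'(1) = ζ(2) = π² / 6`, which evaluates the case `z = 0`.
-/

namespace HarmonicSeries

open Filter Topology Complex

/-! ### The trigamma series -/

/-- The `k`-th term of the logarithm of Euler's product for `w * Γ(w)`, on `0 < re w`. -/
noncomputable def eulerLogTerm (k : ℕ) (w : ℂ) : ℂ :=
  w * (Real.log ((k + 2) / (k + 1)) : ℂ) - Complex.log (1 + w / (k + 1))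

/-- The derivative of `eulerLogTerm`. -/
noncomputable def eulerLogTermDeriv (k : ℕ) (w : ℂ) : ℂ :=
  (Real.log ((k + 2) / (k + 1)) : ℂ) - 1 / (w + (k + 1))

lemma natCast_add_one_le_norm_add {w : ℂ} (hw : 0 < w.re) (k : ℕ) :
    (k : ℝ) + 1 ≤ ‖w + (k + 1)‖ := by
  have := Complex.re_le_norm (w + (k + 1))
  simp at this
  linarith

lemma add_natCast_add_one_ne_zero {w : ℂ} (hw : 0 < w.re) (k : ℕ) : w + (k + 1) ≠ 0 := by
  intro h
  have := natCast_add_one_le_norm_add hw k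
  rw [h, norm_zero] at this
  linarith [k.cast_nonneg (α := ℝ)]

lemma one_add_div_eq (w : ℂ) (k : ℕ) :
    1 + w / ((k : ℂ) + 1) = (w + (k + 1)) / (k + 1) := by
  have : (k : ℂ) + 1 ≠ 0 := Nat.cast_add_one_ne_zero k
  field_simp
  ring

lemma hasDerivAt_eulerLogTerm (k : ℕ) {w : ℂ} (hw : 0 < w.re) :
    HasDerivAt (eulerLogTerm k) (eulerLogTermDeriv k w) w := by
  have hk : (k : ℂ) + 1 ≠ 0 := Nat.cast_add_one_ne_zero k
  have hs : 1 + w / ((k : ℂ) + 1) ∈ slitPlane := by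
    left
    have h : (w / ((k : ℂ) + 1)).re = w.re / (k + 1) := by
      have := Complex.div_natCast_re w (k + 1)
      push_cast at this
      exact this
    rw [Complex.add_re, h, Complex.one_re]
    positivity
  have h1 : HasDerivAt (fun w : ℂ => 1 + w / ((k : ℂ) + 1)) (1 / (k + 1)) w :=
    ((hasDerivAt_id w).div_const _).const_add 1
  have h2 := ((hasDerivAt_id w).mul_const (Real.log ((k + 2) / (k + 1)) : ℂ)).sub
    (h1.clog hs)
  refine h2.congr_deriv ?_
  rw [one_add_div_eq, eulerLogTermDeriv, one_mul]
  have := add_natCast_add_one_ne_zero hw k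
  congr 1
  field_simp

lemma abs_log_sub_le (k : ℕ) :
    |Real.log (((k : ℝ) + 2) / (k + 1)) - 1 / (k + 1)| ≤ 1 / ((k : ℝ) + 1) ^ 2 := by
  have hpos : (0 : ℝ) < (k + 2) / (k + 1) := by positivity
  have hle := Real.log_le_sub_one_of_pos hpos
  have hge := Real.one_sub_inv_le_log_of_pos hpos
  have e1 : ((k : ℝ) + 2) / (k + 1) - 1 = 1 / (k + 1) := by field_simp; ring
  have e2 : 1 - (((k : ℝ) + 2) / (k + 1))⁻¹ = 1 / (k + 2) := by field_simp; ring
  have e3 : 1 / ((k : ℝ) + 1) - 1 / (k + 2) ≤ 1 / ((k : ℝ) + 1) ^ 2 := by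
    rw [div_sub_div _ _ (by positivity) (by positivity),
      div_le_div_iff₀ (by positivity) (by positivity)]
    nlinarith [k.cast_nonneg (α := ℝ)]
  rw [abs_le]
  constructor
  · linarith
  · have : 0 ≤ 1 / ((k : ℝ) + 1) ^ 2 := by positivity
    linarith

lemma norm_eulerLogTermDeriv_le (k : ℕ) {w : ℂ} (hw : 0 < w.re) {R : ℝ} (hR : ‖w‖ ≤ R) :
    ‖eulerLogTermDeriv k w‖ ≤ (1 + R) * (1 / ((k : ℝ) + 1) ^ 2) := by
  have hk : (k : ℂ) + 1 ≠ 0 := Nat.cast_add_one_ne_zero k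
  have hwk := add_natCast_add_one_ne_zero hw k
  have e : eulerLogTermDeriv k w =
      ((Real.log (((k : ℝ) + 2) / (k + 1)) - 1 / (k + 1) : ℝ) : ℂ)
        + w / ((k + 1) * (w + (k + 1))) := by
    rw [eulerLogTermDeriv]
    push_cast
    field_simp
    ring
  have hb : ‖w / (((k : ℂ) + 1) * (w + (k + 1)))‖ ≤ R * (1 / ((k : ℝ) + 1) ^ 2) := by
    have h1 := natCast_add_one_le_norm_add hw k
    have h2 : ‖(k : ℂ) + 1‖ = (k : ℝ) + 1 := by
      have := Complex.norm_natCast (k + 1)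
      push_cast at this
      exact this
    rw [norm_div, norm_mul, h2, ← mul_one_div]
    gcongr
    · exact (norm_nonneg w).trans hR
    · rw [sq]
      gcongr
  calc ‖eulerLogTermDeriv k w‖ ≤ _ := e ▸ norm_add_le _ _
    _ ≤ 1 / ((k : ℝ) + 1) ^ 2 + R * (1 / ((k : ℝ) + 1) ^ 2) := by
      refine add_le_add ?_ hb
      rw [Complex.norm_real, Real.norm_eq_abs]
      exact abs_log_sub_le k
    _ = _ := by ring

lemma summable_one_div_natCast_add_one_sq :
    Summable fun k : ℕ => 1 / ((k : ℝ) + 1) ^ 2 := by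
  have := (summable_nat_add_iff 1).2 (Real.summable_one_div_nat_pow.2 (one_lt_two))
  exact_mod_cast this

/-- Bounded pieces of the right half-plane, on which the series below converge uniformly. -/
def halfDisc (R : ℝ) : Set ℂ := {w | 0 < w.re} ∩ Metric.ball 0 R

lemma isOpen_halfDisc (R : ℝ) : IsOpen (halfDisc R) :=
  (isOpen_lt continuous_const Complex.continuous_re).inter Metric.isOpen_ball

lemma isPreconnected_halfDisc (R : ℝ) : IsPreconnected (halfDisc R) :=
  ((convex_halfSpace_re_gt 0).inter (convex_ball 0 R)).isPreconnected

lemma summable_bound (R : ℝ) : Summable fun k : ℕ => (1 + R) * (1 / ((k : ℝ) + 1) ^ 2) :=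
  summable_one_div_natCast_add_one_sq.mul_left _

lemma norm_eulerLogTermDeriv_le_of_mem {R : ℝ} (k : ℕ) (w : ℂ) (hw : w ∈ halfDisc R) :
    ‖eulerLogTermDeriv k w‖ ≤ (1 + R) * (1 / ((k : ℝ) + 1) ^ 2) :=
  norm_eulerLogTermDeriv_le k hw.1 (mem_ball_zero_iff.1 hw.2).le

lemma eulerLogTerm_one (k : ℕ) : eulerLogTerm k 1 = 0 := by
  have : (1 : ℂ) + 1 / (k + 1) = (((k + 2 : ℝ) / (k + 1) : ℝ) : ℂ) := by
    have : (k : ℂ) + 1 ≠ 0 := Nat.cast_add_one_ne_zero k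
    push_cast
    field_simp
    ring
  rw [eulerLogTerm, this, ← Complex.ofReal_log (by positivity)]
  simp

lemma mem_halfDisc {w : ℂ} (hw : 0 < w.re) : w ∈ halfDisc (‖w‖ + 2) :=
  ⟨hw, by simp⟩

lemma one_mem_halfDisc (w : ℂ) : (1 : ℂ) ∈ halfDisc (‖w‖ + 2) :=
  ⟨by simp, by simpa using by linarith [norm_nonneg w]⟩

lemma summable_eulerLogTerm {w : ℂ} (hw : 0 < w.re) : Summable fun k => eulerLogTerm k w :=
  summable_of_summable_hasDerivAt_of_isPreconnected (summable_bound (‖w‖ + 2))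
    (isOpen_halfDisc _) (isPreconnected_halfDisc _)
    (fun k _ hy => hasDerivAt_eulerLogTerm k hy.1) norm_eulerLogTermDeriv_le_of_mem
    (one_mem_halfDisc w) (by simpa only [eulerLogTerm_one] using summable_zero) (mem_halfDisc hw)

lemma hasDerivAt_tsum_eulerLogTerm {w : ℂ} (hw : 0 < w.re) :
    HasDerivAt (fun w => ∑' k, eulerLogTerm k w) (∑' k, eulerLogTermDeriv k w) w :=
  hasDerivAt_tsum_of_isPreconnected (summable_bound (‖w‖ + 2))
    (isOpen_halfDisc _) (isPreconnected_halfDisc _)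
    (fun k _ hy => hasDerivAt_eulerLogTerm k hy.1) norm_eulerLogTermDeriv_le_of_mem
    (one_mem_halfDisc w) (by simpa only [eulerLogTerm_one] using summable_zero) (mem_halfDisc hw)

/-- The exponentials of the partial sums are Euler's partial products, up to the factor `w` and a
factor tending to one. -/
lemma exp_sum_eulerLogTerm {w : ℂ} (hw : 0 < w.re) (n : ℕ) :
    Complex.exp (∑ k ∈ Finset.range n, eulerLogTerm k w) =
      ((n + 1 : ℕ) : ℂ) ^ w * n.factorial / ∏ j ∈ Finset.range n, (w + (j + 1)) := by
  induction n with
  | zero => simp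
  | succ n ih =>
    have h0 := add_natCast_add_one_ne_zero hw n
    have hn : (n : ℂ) + 1 ≠ 0 := Nat.cast_add_one_ne_zero n
    have hP : ∏ j ∈ Finset.range n, (w + ((j : ℂ) + 1)) ≠ 0 :=
      Finset.prod_ne_zero_iff.2 fun j _ => add_natCast_add_one_ne_zero hw j
    have hlog : ((n + 1 + 1 : ℕ) : ℂ) ^ w =
        ((n + 1 : ℕ) : ℂ) ^ w * Complex.exp (w * (Real.log ((n + 2) / (n + 1)) : ℂ)) := by
      rw [Complex.cpow_def_of_ne_zero (Nat.cast_ne_zero.2 (n + 1).succ_ne_zero),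
        Complex.cpow_def_of_ne_zero (Nat.cast_ne_zero.2 n.succ_ne_zero), ← Complex.exp_add,
        Real.log_div (by positivity) (by positivity), ← Complex.natCast_log, ← Complex.natCast_log]
      congr 1
      push_cast
      ring_nf
    rw [Finset.sum_range_succ, Complex.exp_add, ih, Finset.prod_range_succ, hlog, eulerLogTerm,
      Complex.exp_sub, Complex.exp_log (by rw [one_add_div_eq]; exact div_ne_zero h0 hn),
      one_add_div_eq, Nat.factorial_succ]
    push_cast
    field_simp

/-- Euler's product for `Γ` on the right half-plane, in logarithmic form. -/
lemma Gamma_eq_exp_tsum {w : ℂ} (hw : 0 < w.re) :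
    Complex.Gamma w = Complex.exp (∑' k, eulerLogTerm k w) / w := by
  have hw0 : w ≠ 0 := fun h => by simp [h] at hw
  have h1 : Tendsto (fun n : ℕ => Complex.exp (∑ k ∈ Finset.range n, eulerLogTerm k w) / w *
      (((n + 1 : ℕ) : ℂ) / ((n + 1 : ℕ) + w))) atTop
      (𝓝 (Complex.exp (∑' k, eulerLogTerm k w) / w * 1)) :=
    (((Complex.continuous_exp.tendsto _).comp
      (summable_eulerLogTerm hw).hasSum.tendsto_sum_nat).div_const w).mul
      ((tendsto_natCast_div_add_atTop w).comp (tendsto_add_atTop_nat 1))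
  have h2 := (Complex.GammaSeq_tendsto_Gamma w).comp (tendsto_add_atTop_nat 1)
  rw [mul_one] at h1
  refine tendsto_nhds_unique h2 (h1.congr fun n => ?_)
  have hP : ∏ j ∈ Finset.range n, (w + ((j : ℂ) + 1)) ≠ 0 :=
    Finset.prod_ne_zero_iff.2 fun j _ => add_natCast_add_one_ne_zero hw j
  have h0 := add_natCast_add_one_ne_zero hw n
  have h0' : (n : ℂ) + 1 + w ≠ 0 := by rwa [add_comm]
  rw [exp_sum_eulerLogTerm hw, Function.comp_apply, Complex.GammaSeq,
    Finset.prod_range_succ' (fun j : ℕ => w + (j : ℂ)), Finset.prod_range_succ, Nat.factorial_succ]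
  push_cast
  rw [add_zero]
  field_simp
  ring

lemma digamma_eq_tsum {w : ℂ} (hw : 0 < w.re) :
    Complex.digamma w = ∑' k, eulerLogTermDeriv k w - 1 / w := by
  have hw0 : w ≠ 0 := fun h => by simp [h] at hw
  have hev : Complex.Gamma =ᶠ[𝓝 w] fun w => Complex.exp (∑' k, eulerLogTerm k w) / w := by
    filter_upwards [(isOpen_lt continuous_const Complex.continuous_re).mem_nhds hw] with y hy
    exact Gamma_eq_exp_tsum hy
  have hd := ((hasDerivAt_tsum_eulerLogTerm hw).cexp.div (hasDerivAt_id w) hw0)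
  rw [Complex.digamma_def, logDeriv_apply, hev.deriv_eq, Gamma_eq_exp_tsum hw]
  erw [hd.deriv]
  have := Complex.exp_ne_zero (∑' k, eulerLogTerm k w)
  simp only [id]
  field_simp

/-- The trigamma series `ψ'(w) = ∑ 1 / (w + k) ^ 2`, on the right half-plane. -/
lemma hasSum_deriv_digamma {w : ℂ} (hw : 0 < w.re) :
    HasSum (fun k : ℕ => 1 / (w + k) ^ 2) (deriv Complex.digamma w) := by
  have hw0 : w ≠ 0 := fun h => by simp [h] at hw
  have hd (k : ℕ) (y : ℂ) (hy : 0 < y.re) :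
      HasDerivAt (eulerLogTermDeriv k) (1 / (y + (k + 1)) ^ 2) y := by
    have h0 := add_natCast_add_one_ne_zero hy k
    have := (((hasDerivAt_id y).add_const ((k : ℂ) + 1)).inv h0).const_sub
      (Real.log ((k + 2) / (k + 1)) : ℂ)
    simp only [id, neg_div, neg_neg] at this
    refine this.congr_of_eventuallyEq (.of_forall fun x => ?_)
    simp [eulerLogTermDeriv]
  have hsum := Complex.hasSum_deriv_of_summable_norm (summable_bound (‖w‖ + 2))
    (fun k y hy => (hd k y hy.1).differentiableAt.differentiableWithinAt) (isOpen_halfDisc _)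
    norm_eulerLogTermDeriv_le_of_mem (mem_halfDisc hw)
  have hdiff := (Complex.differentiableOn_tsum_of_summable_norm (summable_bound (‖w‖ + 2))
    (fun k y hy => (hd k y hy.1).differentiableAt.differentiableWithinAt) (isOpen_halfDisc _)
    norm_eulerLogTermDeriv_le_of_mem).differentiableAt
      ((isOpen_halfDisc _).mem_nhds (mem_halfDisc hw))
  have hev : Complex.digamma =ᶠ[𝓝 w] fun w => ∑' k, eulerLogTermDeriv k w - w⁻¹ := by
    filter_upwards [(isOpen_lt continuous_const Complex.continuous_re).mem_nhds hw] with y hy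
    rw [digamma_eq_tsum hy, one_div]
  have hderiv : deriv Complex.digamma w =
      1 / w ^ 2 + deriv (fun w => ∑' k, eulerLogTermDeriv k w) w := by
    rw [hev.deriv_eq]
    erw [(hdiff.hasDerivAt.sub (hasDerivAt_inv hw0)).deriv]
    rw [one_div]
    ring
  rw [hderiv, ← hasSum_nat_add_iff' 1]
  simp only [Finset.range_one, Finset.sum_singleton, Nat.cast_zero, add_zero, add_sub_cancel_left]
  refine hsum.congr_fun ?_
  intro k
  simp [(hd k w hw).deriv]

/-- The derivative of the digamma function tends to zero along right translations: for large
`n` it is the tail of the convergent trigamma series. -/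
lemma tendsto_deriv_digamma_add_nat (w : ℂ) :
    Tendsto (fun n : ℕ => deriv Complex.digamma (w + n)) atTop (𝓝 0) := by
  obtain ⟨m, hm⟩ := exists_nat_gt (-w.re)
  have hpos : 0 < (w + m).re := by simp; linarith
  rw [← tendsto_add_atTop_iff_nat m]
  refine (tendsto_sum_nat_add fun k : ℕ => 1 / (w + m + (k : ℂ)) ^ 2).congr fun n => ?_
  have hn : 0 < (w + ((n + m : ℕ) : ℂ)).re := by
    simp at hpos ⊢
    linarith [n.cast_nonneg (α := ℝ)]
  rw [← (hasSum_deriv_digamma hn).tsum_eq]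
  refine tsum_congr fun k => ?_
  push_cast
  ring_nf

lemma deriv_digamma_one : deriv Complex.digamma 1 = riemannZeta 2 := by
  rw [← (hasSum_deriv_digamma (w := 1) (by simp)).tsum_eq,
    zeta_eq_tsum_one_div_nat_add_one_cpow (s := 2) (by simp)]
  refine tsum_congr fun k => ?_
  rw [add_comm]
  norm_cast

/-! ### Reciprocal binomial coefficients -/

/-- The complex numbers that are not negative integers. -/
def regularSet : Set ℂ := {z | ∀ k : ℕ, z ≠ -((k : ℂ) + 1)}

/-- The domain of the series: the half-plane of convergence without the negative integers. -/
def seriesDomain : Set ℂ := regularSet ∩ {z | -3 < z.re}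

/-- The reciprocal of the binomial coefficient `complexBinom (n + z) n`. -/
noncomputable def invBinom (n : ℕ) (z : ℂ) : ℂ :=
  Complex.Gamma (n + 1) * Complex.Gamma (z + 1) / Complex.Gamma (n + z + 1)

lemma natCast_add_add_one_ne_neg {z : ℂ} (hz : z ∈ regularSet) (n m : ℕ) :
    (n : ℂ) + z + 1 ≠ -m := by
  intro h
  refine hz (n + m) ?_
  push_cast
  linear_combination h

lemma add_one_ne_neg {z : ℂ} (hz : z ∈ regularSet) (m : ℕ) : z + 1 ≠ -m := by
  simpa using natCast_add_add_one_ne_neg hz 0 m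

lemma natCast_add_add_one_ne_zero {z : ℂ} (hz : z ∈ regularSet) (n : ℕ) :
    (n : ℂ) + z + 1 ≠ 0 := by
  simpa using natCast_add_add_one_ne_neg hz n 0

lemma add_one_ne_zero {z : ℂ} (hz : z ∈ regularSet) : z + 1 ≠ 0 := by
  simpa using natCast_add_add_one_ne_zero hz 0

lemma add_one_mem_regularSet {z : ℂ} (hz : z ∈ regularSet) : z + 1 ∈ regularSet := by
  intro k h
  refine hz (k + 1) ?_
  push_cast
  linear_combination h

lemma add_one_mem_seriesDomain {z : ℂ} (hz : z ∈ seriesDomain) : z + 1 ∈ seriesDomain :=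
  ⟨add_one_mem_regularSet hz.1, by have := hz.2; simp at this ⊢; linarith⟩

/-- Openness of the domain: the poles of `Γ` are the zeros of the entire function `1 / Γ`. -/
lemma isOpen_regularSet : IsOpen regularSet := by
  have h : regularSet = (fun z : ℂ => (Complex.Gamma (z + 1))⁻¹) ⁻¹' {0}ᶜ := by
    ext z
    simp only [Set.mem_preimage, Set.mem_compl_iff, Set.mem_singleton_iff, inv_eq_zero,
      Complex.Gamma_eq_zero_iff, not_exists, regularSet, Set.mem_ofPred_eq]
    exact forall_congr' fun k => not_congr
      ⟨fun h => by rw [h]; ring, fun h => by linear_combination h⟩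
  rw [h]
  exact isOpen_compl_singleton.preimage
    (Complex.differentiable_one_div_Gamma.continuous.comp (continuous_id.add continuous_const))

lemma isOpen_seriesDomain : IsOpen seriesDomain :=
  isOpen_regularSet.inter (isOpen_lt continuous_const Complex.continuous_re)

lemma Gamma_add_natCast_add_one_ne_zero {z : ℂ} (hz : z ∈ regularSet) (n : ℕ) :
    Complex.Gamma (n + z + 1) ≠ 0 :=
  Complex.Gamma_ne_zero (natCast_add_add_one_ne_neg hz n)

lemma Gamma_add_one_ne_zero {z : ℂ} (hz : z ∈ regularSet) : Complex.Gamma (z + 1) ≠ 0 :=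
  Complex.Gamma_ne_zero (add_one_ne_neg hz)

lemma invBinom_zero {z : ℂ} (hz : z ∈ regularSet) : invBinom 0 z = 1 := by
  have := Gamma_add_one_ne_zero hz
  simp [invBinom, this]

lemma invBinom_ne_zero {z : ℂ} (hz : z ∈ regularSet) (n : ℕ) : invBinom n z ≠ 0 := by
  refine div_ne_zero (mul_ne_zero ?_ (Gamma_add_one_ne_zero hz))
    (Gamma_add_natCast_add_one_ne_zero hz n)
  rw [Complex.Gamma_nat_eq_factorial]
  exact_mod_cast n.factorial_ne_zero

lemma invBinom_succ {z : ℂ} (hz : z ∈ regularSet) (n : ℕ) :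
    invBinom (n + 1) z = invBinom n z * ((n + 1) / (n + z + 1)) := by
  have h1 := Gamma_add_natCast_add_one_ne_zero hz n
  have h2 := natCast_add_add_one_ne_zero hz n
  have e1 : Complex.Gamma ((n + 1 : ℕ) + z + 1) =
      (n + z + 1) * Complex.Gamma (n + z + 1) := by
    rw [← Complex.Gamma_add_one _ h2]
    push_cast
    ring_nf
  rw [invBinom, invBinom, e1, Complex.Gamma_nat_eq_factorial, Complex.Gamma_nat_eq_factorial,
    Nat.factorial_succ]
  push_cast
  field_simp

lemma invBinom_add_one {z : ℂ} (hz : z ∈ regularSet) (n : ℕ) :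
    invBinom n (z + 1) = invBinom n z * ((z + 1) / (n + z + 1)) := by
  have h1 := Gamma_add_natCast_add_one_ne_zero hz n
  have h2 := natCast_add_add_one_ne_zero hz n
  have e1 : Complex.Gamma (n + (z + 1) + 1) =
      (n + z + 1) * Complex.Gamma (n + z + 1) := by
    rw [← Complex.Gamma_add_one _ h2, ← add_assoc]
  rw [invBinom, invBinom, e1, Complex.Gamma_add_one _ (add_one_ne_zero hz)]
  field_simp

/-- The logarithmic derivative of `invBinom n` is a difference of digamma values; this is how the
harmonic numbers enter the series. -/
lemma hasDerivAt_invBinom {z : ℂ} (hz : z ∈ regularSet) (n : ℕ) :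
    HasDerivAt (invBinom n)
      (invBinom n z * (Complex.digamma (z + 1) - Complex.digamma (n + z + 1))) z := by
  have h1 := Gamma_add_natCast_add_one_ne_zero hz n
  have h2 := Gamma_add_one_ne_zero hz
  have d1 : HasDerivAt (fun z : ℂ => Complex.Gamma (z + 1)) (deriv Complex.Gamma (z + 1)) z :=
    (Complex.differentiableAt_Gamma _ (add_one_ne_neg hz)).hasDerivAt.comp_add_const z 1
  have d2 : HasDerivAt (fun z : ℂ => Complex.Gamma (n + z + 1))
      (deriv Complex.Gamma (n + z + 1)) z := by
    have := (Complex.differentiableAt_Gamma _ (natCast_add_add_one_ne_neg hz n)).hasDerivAt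
    rw [show (n : ℂ) + z + 1 = z + (n + 1) by ring] at this ⊢
    refine (this.comp_add_const z ((n : ℂ) + 1)).congr_of_eventuallyEq (.of_forall fun x => ?_)
    simp only
    congr 1
    ring
  refine ((d1.const_mul (Complex.Gamma (n + 1))).div d2 h1).congr_deriv ?_
  rw [Complex.digamma_def, logDeriv_apply, logDeriv_apply, invBinom]
  field_simp

/-! ### Growth of the reciprocal binomial coefficients -/

lemma invBinom_mul_prod {z : ℂ} (hz : z ∈ regularSet) (n : ℕ) :
    invBinom n z * ∏ j ∈ Finset.range n, (z + ((j + 1 : ℕ) : ℂ)) = n.factorial := by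
  induction n with
  | zero => simp [invBinom_zero hz]
  | succ n ih =>
    have h := natCast_add_add_one_ne_zero hz n
    rw [invBinom_succ hz, Finset.prod_range_succ, Nat.factorial_succ]
    push_cast at ih ⊢
    rw [← ih, show z + ((n : ℂ) + 1) = n + z + 1 by ring]
    field_simp

lemma cpow_mul_invBinom {z : ℂ} (hz : z ∈ regularSet) (hz0 : z ≠ 0) (n : ℕ) :
    (n : ℂ) ^ z * invBinom n z = z * Complex.GammaSeq z n := by
  have hP : ∏ j ∈ Finset.range n, (z + ((j + 1 : ℕ) : ℂ)) ≠ 0 :=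
    Finset.prod_ne_zero_iff.2 fun j _ => by
      have := natCast_add_add_one_ne_zero hz j
      push_cast
      rwa [show z + ((j : ℂ) + 1) = j + z + 1 by ring]
  rw [Complex.GammaSeq, Finset.prod_range_succ', ← invBinom_mul_prod hz n, Nat.cast_zero, add_zero]
  field_simp

/-- By Euler's limit formula, `invBinom n z` is `O(n ^ (-re z))`. -/
lemma exists_norm_invBinom_le {z : ℂ} (hz : z ∈ regularSet) (hz0 : z ≠ 0) :
    ∃ C : ℝ, ∀ n : ℕ, 0 < n → ‖invBinom n z‖ ≤ C * (n : ℝ) ^ (-z.re) := by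
  obtain ⟨C, hC⟩ := ((Complex.GammaSeq_tendsto_Gamma z).const_mul z).norm.bddAbove_range
  refine ⟨C, fun n hn => ?_⟩
  have h : ‖z * Complex.GammaSeq z n‖ ≤ C := hC ⟨n, rfl⟩
  rw [← cpow_mul_invBinom hz hz0, norm_mul, Complex.norm_natCast_cpow_of_pos hn] at h
  have hpos : (0 : ℝ) < (n : ℝ) ^ z.re := Real.rpow_pos_of_pos (by exact_mod_cast hn) _
  rw [Real.rpow_neg n.cast_nonneg, ← div_eq_mul_inv, le_div_iff₀ hpos, mul_comm]
  exact h

lemma norm_natCast_add_ofReal {σ : ℝ} (n : ℕ) (h : 0 < (n : ℝ) + σ + 1) :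
    ‖(n : ℂ) + σ + 1‖ = n + σ + 1 := by
  rw [show (n : ℂ) + σ + 1 = ((n + σ + 1 : ℝ) : ℂ) by push_cast; rfl,
    Complex.norm_real, Real.norm_of_nonneg h.le]

/-- Comparison of `invBinom n z` with its value at a real point to the left of `z`. It starts at
`n = 2`, from where on the factors `n + σ + 1` are positive. -/
lemma norm_invBinom_mul_le {σ : ℝ} (hσ : -3 < σ) (hσr : (σ : ℂ) ∈ regularSet) {z : ℂ}
    (hz : z ∈ regularSet) (hσz : σ ≤ z.re) (n : ℕ) (hn : 2 ≤ n) :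
    ‖invBinom n z‖ * ‖invBinom 2 (σ : ℂ)‖ ≤ ‖invBinom 2 z‖ * ‖invBinom n (σ : ℂ)‖ := by
  induction n, hn using Nat.le_induction with
  | base => rw [mul_comm]
  | succ n hn ih =>
    have hn' : (2 : ℝ) ≤ n := by exact_mod_cast hn
    have hpos : 0 < (n : ℝ) + σ + 1 := by linarith
    have hle : (n : ℝ) + σ + 1 ≤ ‖(n : ℂ) + z + 1‖ := by
      have := Complex.re_le_norm ((n : ℂ) + z + 1)
      simp at this
      linarith
    rw [invBinom_succ hz n, invBinom_succ hσr n, norm_mul, norm_mul, norm_div, norm_div,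
      norm_natCast_add_ofReal n hpos]
    calc _ = (‖invBinom n z‖ * ‖invBinom 2 (σ : ℂ)‖) * (‖(n : ℂ) + 1‖ / ‖(n : ℂ) + z + 1‖) := by
          ring
      _ ≤ (‖invBinom 2 z‖ * ‖invBinom n (σ : ℂ)‖) * (‖(n : ℂ) + 1‖ / (n + σ + 1)) := by
          gcongr
      _ = _ := by ring

lemma ofReal_mem_regularSet {σ : ℝ} (h1 : -3 < σ) (h2 : σ < -2) : (σ : ℂ) ∈ regularSet := by
  intro k h
  have h' : σ = -((k : ℝ) + 1) := by exact_mod_cast h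
  have h3 : (k : ℝ) < 2 := by linarith
  have h4 : (1 : ℝ) < k := by linarith
  have h5 : k < 2 := by exact_mod_cast h3
  have h6 : 1 < k := by exact_mod_cast h4
  omega

/-- The locally uniform form of the bound `invBinom n z = O(n ^ (-re z))`. The exponent `σ` is taken
in `(-3, -2)`, where `invBinom n σ` has no poles. -/
lemma exists_norm_invBinom_le_nhds {z₀ : ℂ} (hz₀ : z₀ ∈ seriesDomain) :
    ∃ V ⊆ seriesDomain, IsOpen V ∧ z₀ ∈ V ∧ ∃ σ : ℝ, -3 < σ ∧ ∃ K : ℝ, ∀ n : ℕ, 0 < n →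
      ∀ z ∈ V, ‖invBinom n z‖ ≤ K * (n : ℝ) ^ (-σ) := by
  obtain ⟨σ, hσ1, hσ2⟩ : ∃ σ : ℝ, -3 < σ ∧ σ < min z₀.re (-2) :=
    exists_between (lt_min hz₀.2 (by norm_num))
  have hσr := ofReal_mem_regularSet hσ1 (hσ2.trans_le (min_le_right _ _))
  have hσ0 : (σ : ℂ) ≠ 0 := by
    have := hσ2.trans_le (min_le_right _ _)
    exact_mod_cast (by linarith : σ < 0).ne
  obtain ⟨C, hC⟩ := exists_norm_invBinom_le hσr hσ0
  set M1 := ‖invBinom 1 z₀‖ + 1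
  set M2 := ‖invBinom 2 z₀‖ + 1
  have hev : ∀ᶠ z in 𝓝 z₀, z ∈ seriesDomain ∧ σ < z.re ∧ ‖invBinom 1 z‖ < M1 ∧
      ‖invBinom 2 z‖ < M2 := by
    have hc (n : ℕ) := (hasDerivAt_invBinom hz₀.1 n).continuousAt.norm
    exact (isOpen_seriesDomain.eventually_mem hz₀).and
      ((Complex.continuous_re.continuousAt.eventually_const_lt
        (hσ2.trans_le (min_le_left _ _))).and
      (((hc 1).eventually_lt_const (lt_add_one _)).and
      ((hc 2).eventually_lt_const (lt_add_one _))))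
  obtain ⟨V, hV, hVo, hzV⟩ := eventually_nhds_iff.1 hev
  refine ⟨V, fun z hz => (hV z hz).1, hVo, hzV, σ, hσ1, max M1 (M2 * C / ‖invBinom 2 (σ : ℂ)‖), ?_⟩
  intro n hn z hz
  obtain ⟨hzU, hσz, h1, h2⟩ := hV z hz
  have hpow : 0 < (n : ℝ) ^ (-σ) := Real.rpow_pos_of_pos (by exact_mod_cast hn) _
  obtain rfl | hn2 : n = 1 ∨ 2 ≤ n := by omega
  · simpa using Or.inl h1.le
  · have hpos : 0 < ‖invBinom 2 (σ : ℂ)‖ := norm_pos_iff.2 (invBinom_ne_zero hσr 2)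
    have h3 := norm_invBinom_mul_le hσ1 hσr hzU.1 hσz.le n hn2
    have h4 := hC n hn
    rw [Complex.ofReal_re] at h4
    have h5 : ‖invBinom n z‖ ≤ M2 * C / ‖invBinom 2 (σ : ℂ)‖ * (n : ℝ) ^ (-σ) := by
      rw [div_mul_eq_mul_div, le_div_iff₀ hpos]
      calc _ ≤ _ := h3
        _ ≤ M2 * (C * (n : ℝ) ^ (-σ)) := by gcongr
        _ = _ := by ring
    exact h5.trans (by gcongr; exact le_max_right _ _)

/-- For `re z ≥ 0` the reciprocal binomial coefficients are bounded by one. -/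
lemma norm_invBinom_le_one {z : ℂ} (hz : z ∈ regularSet) (h0 : 0 ≤ z.re) (n : ℕ) :
    ‖invBinom n z‖ ≤ 1 := by
  induction n with
  | zero => simp [invBinom_zero hz]
  | succ n ih =>
    rw [invBinom_succ hz, norm_mul, norm_div]
    refine mul_le_one₀ ih (by positivity) (div_le_one_of_le₀ ?_ (norm_nonneg _))
    have h1 := Complex.re_le_norm ((n : ℂ) + z + 1)
    have h2 : ‖(n : ℂ) + 1‖ = (n : ℝ) + 1 := by
      have := Complex.norm_natCast (n + 1)
      push_cast at this
      exact this
    simp at h1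
    linarith

/-! ### The series without harmonic numbers -/

/-- The terms of the series without their harmonic numbers, indexed from zero. -/
noncomputable def baseTerm (n : ℕ) (z : ℂ) : ℂ :=
  invBinom (n + 1) z / ((n + 1) * (n + 2) * (n + 3) * (n + 4))

/-- The sum of the `baseTerm`s. The series of the theorem is `H_z * baseSum z - baseSum' z`. -/
noncomputable def baseSum (z : ℂ) : ℂ := ∑' n, baseTerm n z

lemma norm_natCast_add_natCast (n m : ℕ) : ‖(n : ℂ) + (m : ℂ)‖ = (n : ℝ) + m := by
  have := Complex.norm_natCast (n + m)
  push_cast at this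
  exact this

lemma norm_baseTerm (n : ℕ) (z : ℂ) : ‖baseTerm n z‖ =
    ‖invBinom (n + 1) z‖ / (((n : ℝ) + 1) * (n + 2) * (n + 3) * (n + 4)) := by
  have h1 := norm_natCast_add_natCast n 1
  have h2 := norm_natCast_add_natCast n 2
  have h3 := norm_natCast_add_natCast n 3
  have h4 := norm_natCast_add_natCast n 4
  push_cast at h1 h2 h3 h4
  rw [baseTerm, norm_div, norm_mul, norm_mul, norm_mul, h1, h2, h3, h4]

lemma hasDerivAt_baseTerm {z : ℂ} (hz : z ∈ regularSet) (n : ℕ) :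
    HasDerivAt (baseTerm n)
      (baseTerm n z * (Complex.digamma (z + 1) - Complex.digamma ((n + 1 : ℕ) + z + 1))) z := by
  refine ((hasDerivAt_invBinom hz (n + 1)).div_const _).congr_deriv ?_
  rw [baseTerm]
  ring

lemma differentiableOn_baseTerm {V : Set ℂ} (hV : V ⊆ seriesDomain) (n : ℕ) :
    DifferentiableOn ℂ (baseTerm n) V := fun _ hz =>
  (hasDerivAt_baseTerm (hV hz).1 n).differentiableAt.differentiableWithinAt

/-- Locally uniform domination of the series, by a multiple of `n ^ (-σ - 4)` with `σ > -3`. -/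
lemma exists_summable_bound {z₀ : ℂ} (hz₀ : z₀ ∈ seriesDomain) :
    ∃ V ⊆ seriesDomain, IsOpen V ∧ z₀ ∈ V ∧ ∃ u : ℕ → ℝ, Summable u ∧
      ∀ n, ∀ z ∈ V, ‖baseTerm n z‖ ≤ u n := by
  obtain ⟨V, hVU, hVo, hzV, σ, hσ, K, hK⟩ := exists_norm_invBinom_le_nhds hz₀
  refine ⟨V, hVU, hVo, hzV, fun n => K * ((n + 1 : ℕ) : ℝ) ^ (-σ - 4), ?_, fun n z hz => ?_⟩
  · exact ((summable_nat_add_iff 1).2 (Real.summable_nat_rpow.2 (by linarith))).mul_left K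
  · have h := hK (n + 1) n.succ_pos z hz
    have hpos : (0 : ℝ) < ((n + 1 : ℕ) : ℝ) := by exact_mod_cast n.succ_pos
    have h4 : ((n + 1 : ℕ) : ℝ) ^ (-σ - 4) = ((n + 1 : ℕ) : ℝ) ^ (-σ) / ((n + 1 : ℕ) : ℝ) ^ 4 := by
      rw [Real.rpow_sub hpos]
      norm_cast
    have hd : ((n + 1 : ℕ) : ℝ) ^ 4 ≤ ((n : ℝ) + 1) * (n + 2) * (n + 3) * (n + 4) := by
      push_cast
      rw [pow_succ, pow_succ, sq]
      gcongr <;> norm_num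
    simp only
    rw [norm_baseTerm, h4, ← mul_div_assoc]
    exact div_le_div₀ ((norm_nonneg _).trans h) h (by positivity) hd

lemma summable_baseTerm {z : ℂ} (hz : z ∈ seriesDomain) : Summable fun n => baseTerm n z := by
  obtain ⟨V, -, -, hzV, u, hu, hb⟩ := exists_summable_bound hz
  exact hu.of_norm_bounded fun n => hb n z hzV

lemma hasSum_deriv_baseTerm {z : ℂ} (hz : z ∈ seriesDomain) :
    HasSum (fun n : ℕ =>
      baseTerm n z * (Complex.digamma (z + 1) - Complex.digamma ((n + 1 : ℕ) + z + 1)))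
      (deriv baseSum z) := by
  obtain ⟨V, hVU, hVo, hzV, u, hu, hb⟩ := exists_summable_bound hz
  have := Complex.hasSum_deriv_of_summable_norm hu (differentiableOn_baseTerm hVU) hVo hb hzV
  simp only [(hasDerivAt_baseTerm hz.1 _).deriv] at this
  exact this

/-! ### The functional equation -/

/-- Telescoping antidifference of `n ↦ (z + 3) * baseTerm n z - z * baseTerm n (z + 1)`. -/
noncomputable def antidiff (n : ℕ) (z : ℂ) : ℂ :=
  invBinom (n + 1) z / ((n + 1) * (n + 2) * (n + 3))

lemma antidiff_sub_succ {z : ℂ} (hz : z ∈ regularSet) (n : ℕ) :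
    antidiff n z - antidiff (n + 1) z = (z + 3) * baseTerm n z - z * baseTerm n (z + 1) := by
  have h := natCast_add_add_one_ne_zero hz (n + 1)
  have h1 : (n : ℂ) + 1 ≠ 0 := Nat.cast_add_one_ne_zero n
  have h2 : (n : ℂ) + 2 ≠ 0 := by exact_mod_cast (n + 1).succ_ne_zero
  have h3 : (n : ℂ) + 3 ≠ 0 := by exact_mod_cast (n + 2).succ_ne_zero
  have h4 : (n : ℂ) + 4 ≠ 0 := by exact_mod_cast (n + 3).succ_ne_zero
  rw [antidiff, antidiff, baseTerm, baseTerm, invBinom_succ hz (n + 1), invBinom_add_one hz]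
  push_cast at h ⊢
  have h2' : (n : ℂ) + 1 + 1 ≠ 0 := by rwa [add_assoc, one_add_one_eq_two]
  have h3' : (n : ℂ) + 1 + 2 ≠ 0 := by
    rwa [add_assoc, show (1 : ℂ) + 2 = 3 by norm_num]
  have h4' : (n : ℂ) + 1 + 3 ≠ 0 := by
    rwa [add_assoc, show (1 : ℂ) + 3 = 4 by norm_num]
  field_simp
  ring

lemma tendsto_antidiff {z : ℂ} (hz : z ∈ seriesDomain) :
    Tendsto (fun n => antidiff n z) atTop (𝓝 0) := by
  -- `antidiff n z = (n + 4) * baseTerm n z`, so summability alone is not enough here.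
  obtain ⟨V, hVU, hVo, hzV, σ, hσ, K, hK⟩ := exists_norm_invBinom_le_nhds hz
  have hlim : Tendsto (fun n : ℕ => K * ((n + 1 : ℕ) : ℝ) ^ (-(σ + 3))) atTop (𝓝 0) := by
    have := ((tendsto_rpow_neg_atTop (by linarith : 0 < σ + 3)).comp
      (tendsto_natCast_atTop_atTop.comp (tendsto_add_atTop_nat 1))).const_mul K
    simpa using! this
  refine squeeze_zero_norm (fun n => ?_) hlim
  have h := hK (n + 1) n.succ_pos z hzV
  have hpos : (0 : ℝ) < ((n + 1 : ℕ) : ℝ) := by exact_mod_cast n.succ_pos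
  have h4 : ((n + 1 : ℕ) : ℝ) ^ (-(σ + 3)) =
      ((n + 1 : ℕ) : ℝ) ^ (-σ) / ((n + 1 : ℕ) : ℝ) ^ 3 := by
    rw [show -(σ + 3) = -σ - 3 by ring, Real.rpow_sub hpos]
    norm_cast
  have hd : ((n + 1 : ℕ) : ℝ) ^ 3 ≤ ((n : ℝ) + 1) * (n + 2) * (n + 3) := by
    push_cast
    rw [pow_succ, sq]
    gcongr <;> norm_num
  have h1 := norm_natCast_add_natCast n 1
  have h2 := norm_natCast_add_natCast n 2
  have h3 := norm_natCast_add_natCast n 3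
  push_cast at h1 h2 h3
  rw [antidiff, norm_div, norm_mul, norm_mul, h1, h2, h3, h4, ← mul_div_assoc]
  exact div_le_div₀ ((norm_nonneg _).trans h) h (by positivity) hd

lemma baseSum_functional_equation {z : ℂ} (hz : z ∈ seriesDomain) :
    (z + 3) * baseSum z - z * baseSum (z + 1) = 1 / (6 * (z + 1)) := by
  have h1 := (((summable_baseTerm hz).hasSum.mul_left (z + 3)).sub
    ((summable_baseTerm (add_one_mem_seriesDomain hz)).hasSum.mul_left z)).tendsto_sum_nat
  have h2 : Tendsto (fun N : ℕ => antidiff 0 z - antidiff N z) atTop (𝓝 (antidiff 0 z - 0)) :=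
    (tendsto_antidiff hz).const_sub _
  have h3 : antidiff 0 z - 0 = 1 / (6 * (z + 1)) := by
    have := add_one_ne_zero hz.1
    rw [antidiff, invBinom_succ hz.1, invBinom_zero hz.1]
    push_cast
    simp only [zero_add]
    field_simp
    norm_num
  rw [← h3]
  refine tendsto_nhds_unique h1 (h2.congr fun N => ?_)
  rw [← Finset.sum_range_sub' (fun n => antidiff n z)]
  exact Finset.sum_congr rfl fun n _ => antidiff_sub_succ hz.1 n

/-! ### Closed form of the series without harmonic numbers -/

/-- The closed form of `baseSum`. -/
noncomputable def baseClosed (z : ℂ) : ℂ :=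
  -(1 / 12) * (z * (z + 1) * (z + 2)) * deriv Complex.digamma (z + 1)
    + (z ^ 2 / 12 + 5 * z / 24 + 1 / 18)

lemma isOpen_digammaDomain : IsOpen {w : ℂ | w - 1 ∈ regularSet} :=
  isOpen_regularSet.preimage (continuous_id.sub continuous_const)

lemma differentiableOn_digamma :
    DifferentiableOn ℂ Complex.digamma {w : ℂ | w - 1 ∈ regularSet} := by
  have hne (w : ℂ) (hw : w - 1 ∈ regularSet) (m : ℕ) : w ≠ -m := by
    simpa using add_one_ne_neg hw m
  have hG : DifferentiableOn ℂ Complex.Gamma {w : ℂ | w - 1 ∈ regularSet} := fun w hw =>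
    (Complex.differentiableAt_Gamma w (hne w hw)).differentiableWithinAt
  exact (hG.deriv isOpen_digammaDomain).div hG fun w hw => Complex.Gamma_ne_zero (hne w hw)

lemma hasDerivAt_digamma_add_one {z : ℂ} (hz : z ∈ regularSet) :
    HasDerivAt (fun z => Complex.digamma (z + 1)) (deriv Complex.digamma (z + 1)) z :=
  ((differentiableOn_digamma.differentiableAt (isOpen_digammaDomain.mem_nhds
    (by simpa using hz))).hasDerivAt).comp_add_const z 1

lemma hasDerivAt_deriv_digamma_add_one {z : ℂ} (hz : z ∈ regularSet) :
    HasDerivAt (fun z => deriv Complex.digamma (z + 1))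
      (deriv (deriv Complex.digamma) (z + 1)) z :=
  (((differentiableOn_digamma.deriv isOpen_digammaDomain).differentiableAt
    (isOpen_digammaDomain.mem_nhds (by simpa using hz))).hasDerivAt).comp_add_const z 1

lemma deriv_digamma_add_two {z : ℂ} (hz : z ∈ regularSet) :
    deriv Complex.digamma (z + 1 + 1) = deriv Complex.digamma (z + 1) - 1 / (z + 1) ^ 2 := by
  have h0 := add_one_ne_zero hz
  have hev : (fun y => Complex.digamma (y + 1 + 1)) =ᶠ[𝓝 z]
      fun y => Complex.digamma (y + 1) + (y + 1)⁻¹ := by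
    filter_upwards [isOpen_regularSet.mem_nhds hz] with y hy
    exact Complex.digamma_apply_add_one _ (add_one_ne_neg hy)
  have h1 : HasDerivAt (fun y => Complex.digamma (y + 1 + 1))
      (deriv Complex.digamma (z + 1 + 1)) z :=
    (hasDerivAt_digamma_add_one (add_one_mem_regularSet hz)).comp_add_const z 1
  have h2 := (hasDerivAt_digamma_add_one hz).add (((hasDerivAt_id z).add_const (1 : ℂ)).inv h0)
  have h3 := h1.unique (h2.congr_of_eventuallyEq hev)
  rw [h3]
  simp only [id]
  ring

lemma baseClosed_functional_equation {z : ℂ} (hz : z ∈ regularSet) :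
    (z + 3) * baseClosed z - z * baseClosed (z + 1) = 1 / (6 * (z + 1)) := by
  have h0 := add_one_ne_zero hz
  rw [baseClosed, baseClosed, deriv_digamma_add_two hz]
  field_simp
  ring

lemma tendsto_inv_add_natCast (z : ℂ) : Tendsto (fun n : ℕ => (z + n)⁻¹) atTop (𝓝 0) := by
  refine tendsto_inv₀_cobounded.comp (tendsto_norm_atTop_iff_cobounded.1 ?_)
  refine tendsto_atTop_mono (fun n => ?_)
    (tendsto_atTop_add_const_right _ (-‖z‖) tendsto_natCast_atTop_atTop)
  have := norm_sub_norm_le ((n : ℂ)) (-z)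
  rw [norm_neg, Complex.norm_natCast, sub_neg_eq_add, add_comm (n : ℂ)] at this
  linarith

lemma add_natCast_mem_seriesDomain {z : ℂ} (hz : z ∈ seriesDomain) (n : ℕ) :
    z + n ∈ seriesDomain := by
  induction n with
  | zero => simpa using hz
  | succ n ih =>
    push_cast
    rw [← add_assoc]
    exact add_one_mem_seriesDomain ih

lemma add_two_ne_zero {z : ℂ} (hz : z ∈ regularSet) : z + 2 ≠ 0 := by
  have := natCast_add_add_one_ne_zero hz 1
  rwa [show ((1 : ℕ) : ℂ) + z + 1 = z + 2 by push_cast; ring] at this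

lemma add_three_ne_zero {z : ℂ} (hz : z ∈ regularSet) : z + 3 ≠ 0 := by
  have := natCast_add_add_one_ne_zero hz 2
  rwa [show ((2 : ℕ) : ℂ) + z + 1 = z + 3 by push_cast; ring] at this

lemma add_natCast_ne_zero {z : ℂ} (hz : z ∈ regularSet) (hz0 : z ≠ 0) (n : ℕ) : z + n ≠ 0 := by
  cases n with
  | zero => simpa using hz0
  | succ n =>
    have := natCast_add_add_one_ne_zero hz n
    rwa [show z + ((n + 1 : ℕ) : ℂ) = n + z + 1 by push_cast; ring]

lemma norm_baseSum_le {z : ℂ} (hz : z ∈ seriesDomain) (h0 : 0 ≤ z.re) :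
    ‖baseSum z‖ ≤ ∑' n : ℕ, 1 / ((n : ℝ) + 1) ^ 2 := by
  refine tsum_of_norm_bounded summable_one_div_natCast_add_one_sq.hasSum fun n => ?_
  rw [norm_baseTerm]
  refine div_le_div₀ zero_le_one (norm_invBinom_le_one hz.1 h0 _) (by positivity) ?_
  have hn : (0 : ℝ) ≤ n := n.cast_nonneg
  nlinarith [mul_nonneg hn hn, mul_nonneg (mul_nonneg hn hn) hn,
    mul_nonneg (mul_nonneg hn hn) (mul_nonneg hn hn)]

lemma tendsto_baseSum_div {z : ℂ} (hz : z ∈ seriesDomain) :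
    Tendsto (fun n : ℕ => baseSum (z + n) *
      ((z + n)⁻¹ * (z + 1 + n)⁻¹ * (z + 2 + n)⁻¹)) atTop (𝓝 0) := by
  have hinv : Tendsto (fun n : ℕ => (z + n)⁻¹ * (z + 1 + n)⁻¹ * (z + 2 + n)⁻¹) atTop (𝓝 0) := by
    simpa using ((tendsto_inv_add_natCast z).mul (tendsto_inv_add_natCast (z + 1))).mul
      (tendsto_inv_add_natCast (z + 2))
  refine squeeze_zero_norm' (a := fun n : ℕ => (∑' n : ℕ, 1 / ((n : ℝ) + 1) ^ 2) *
    ‖(z + n)⁻¹ * (z + 1 + n)⁻¹ * (z + 2 + n)⁻¹‖) ?_ (by simpa using hinv.norm.const_mul _)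
  filter_upwards [eventually_ge_atTop 3] with n hn
  rw [norm_mul]
  gcongr
  refine norm_baseSum_le (add_natCast_mem_seriesDomain hz n) ?_
  have h1 : (3 : ℝ) ≤ n := by exact_mod_cast hn
  have h2 : -3 < z.re := hz.2
  simp
  linarith

lemma tendsto_baseClosed_div {z : ℂ} (hz : z ∈ regularSet) (hz0 : z ≠ 0) :
    Tendsto (fun n : ℕ => baseClosed (z + n) *
      ((z + n)⁻¹ * (z + 1 + n)⁻¹ * (z + 2 + n)⁻¹)) atTop (𝓝 0) := by
  -- Partial fractions of `(z² / 12 + 5 z / 24 + 1 / 18) / (z (z + 1) (z + 2))`.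
  have h : Tendsto (fun n : ℕ => -(1 / 12) * deriv Complex.digamma (z + 1 + n)
      + (1 / 36) * (z + n)⁻¹ + (5 / 72) * (z + 1 + n)⁻¹ + (-1 / 72) * (z + 2 + n)⁻¹) atTop
      (𝓝 (-(1 / 12) * 0 + (1 / 36) * 0 + (5 / 72) * 0 + (-1 / 72) * 0)) :=
    ((((tendsto_deriv_digamma_add_nat (z + 1)).const_mul _).add
      ((tendsto_inv_add_natCast z).const_mul _)).add
      ((tendsto_inv_add_natCast (z + 1)).const_mul _)).add
      ((tendsto_inv_add_natCast (z + 2)).const_mul _)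
  simp only [mul_zero, add_zero] at h
  refine h.congr fun n => ?_
  have h0 := add_natCast_ne_zero hz hz0 n
  have h1 : z + 1 + n ≠ 0 := by
    have := add_natCast_ne_zero hz hz0 (n + 1)
    rwa [show z + ((n + 1 : ℕ) : ℂ) = z + 1 + n by push_cast; ring] at this
  have h2 : z + 2 + n ≠ 0 := by
    have := add_natCast_ne_zero hz hz0 (n + 2)
    rwa [show z + ((n + 2 : ℕ) : ℂ) = z + 2 + n by push_cast; ring] at this
  rw [baseClosed, show z + n + 1 = z + 1 + n by ring, show z + n + 2 = z + 2 + n by ring]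
  field_simp
  ring

/-- Both sides satisfy the same functional equation, so their difference divided by
`z * (z + 1) * (z + 2)` is invariant under `z ↦ z + 1`; it also tends to zero to the right. -/
lemma baseSum_eq_baseClosed {z : ℂ} (hz : z ∈ seriesDomain) : baseSum z = baseClosed z := by
  obtain rfl | hz0 := eq_or_ne z 0
  · have h1 := baseSum_functional_equation hz
    have h2 := baseClosed_functional_equation hz.1
    have h3 : (3 : ℂ) * (baseSum 0 - baseClosed 0) = 0 := by linear_combination h1 - h2
    exact sub_eq_zero.1 ((mul_eq_zero.1 h3).resolve_left (by norm_num))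
  · set E : ℕ → ℂ := fun n => (baseSum (z + n) - baseClosed (z + n)) *
      ((z + n)⁻¹ * (z + 1 + n)⁻¹ * (z + 2 + n)⁻¹) with hE
    have hlim : Tendsto E atTop (𝓝 0) := by
      have := (tendsto_baseSum_div hz).sub (tendsto_baseClosed_div hz.1 hz0)
      rw [sub_zero] at this
      exact this.congr fun n => (sub_mul _ _ _).symm
    have hstep (n : ℕ) : E (n + 1) = E n := by
      have hw := add_natCast_mem_seriesDomain hz n
      have hw0 := add_natCast_ne_zero hz.1 hz0 n
      simp only [hE]
      push_cast
      rw [show z + ((n : ℂ) + 1) = z + n + 1 by ring,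
        show z + 1 + ((n : ℂ) + 1) = z + n + 2 by ring,
        show z + 2 + ((n : ℂ) + 1) = z + n + 3 by ring, show z + 1 + (n : ℂ) = z + n + 1 by ring,
        show z + 2 + (n : ℂ) = z + n + 2 by ring]
      generalize z + (n : ℂ) = w at hw hw0
      have h1 := add_one_ne_zero hw.1
      have h2 := add_two_ne_zero hw.1
      have h3 := add_three_ne_zero hw.1
      have h := (baseSum_functional_equation hw).trans (baseClosed_functional_equation hw.1).symm
      field_simp
      linear_combination -h
    have hconst (n : ℕ) : E n = E 0 := by
      induction n with
      | zero => rfl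
      | succ n ih => rw [hstep, ih]
    have h0 : E 0 = 0 :=
      tendsto_nhds_unique (tendsto_const_nhds.congr fun n => (hconst n).symm) hlim
    have h1 := add_one_ne_zero hz.1
    have h2 := add_two_ne_zero hz.1
    simp only [hE, Nat.cast_zero, add_zero, mul_eq_zero, inv_eq_zero, hz0, h1, h2, or_false] at h0
    exact sub_eq_zero.1 h0

/-! ### The series with harmonic numbers -/

lemma invBinom_eq_inv_complexBinom (n : ℕ) (z : ℂ) :
    invBinom n z = (complexBinom (n + z) n)⁻¹ := by
  rw [complexBinom, invBinom, inv_div, add_sub_cancel_left]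

lemma hasDerivAt_baseClosed {z : ℂ} (hz : z ∈ regularSet) :
    HasDerivAt baseClosed
      (-(1 / 12) * ((3 * z ^ 2 + 6 * z + 2) * deriv Complex.digamma (z + 1)
        + z * (z + 1) * (z + 2) * deriv (deriv Complex.digamma) (z + 1)) + (z / 6 + 5 / 24)) z := by
  have hi := hasDerivAt_id z
  have hQ := (hi.mul (hi.add_const (1 : ℂ))).mul (hi.add_const (2 : ℂ))
  have hp := (((hi.pow 2).div_const 12).add ((hi.const_mul (5 : ℂ)).div_const 24)).add_const
    (1 / 18 : ℂ)
  refine (((hQ.const_mul (-(1 / 12) : ℂ)).mul (hasDerivAt_deriv_digamma_add_one hz)).add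
    hp).congr_deriv ?_
  simp
  ring

lemma hasSum_harmonic_mul_baseTerm {z : ℂ} (hz : z ∈ seriesDomain) :
    HasSum (fun n : ℕ => complexHarmonic ((n + 1 : ℕ) + z) * baseTerm n z)
      (complexHarmonic z * baseClosed z - deriv baseClosed z) := by
  have hev : baseSum =ᶠ[𝓝 z] baseClosed := by
    filter_upwards [isOpen_seriesDomain.mem_nhds hz] with y hy
    exact baseSum_eq_baseClosed hy
  have h1 := (summable_baseTerm hz).hasSum.mul_left (complexHarmonic z)
  rw [show ∑' n, baseTerm n z = baseClosed z from baseSum_eq_baseClosed hz] at h1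
  have h2 := h1.sub (hasSum_deriv_baseTerm hz)
  rw [hev.deriv_eq] at h2
  refine h2.congr_fun fun n => ?_
  rw [complexHarmonic, complexHarmonic]
  ring

/-- Since `invBinom n` has logarithmic derivative `H_z - H_{n + z}`, the sum is
`H_z * baseSum z - baseSum' z`, and `baseSum` is given near `z` by its closed form. -/
theorem hasSum_complexHarmonic {z : ℂ} (hz : z ∈ seriesDomain) :
    HasSum
      (fun n : ℕ+ =>
        complexHarmonic ((n : ℂ) + z) /
          ((n : ℂ) * ((n : ℂ) + 1) * ((n : ℂ) + 2) * ((n : ℂ) + 3) *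
            complexBinom ((n : ℂ) + z) (n : ℂ)))
      ((1 / 12 * z * (z + 1) * (z + 2) * complexHarmonic z - z * (z + 2) / 4 - 1 / 6) *
          (complexGenHarmonic 2 z - riemannZeta 2)
        + 1 / 6 * z * (z + 1) * (z + 2) * (complexGenHarmonic 3 z - riemannZeta 3)
        + (z ^ 2 / 12 + 5 * z / 24 + 1 / 18) * complexHarmonic z
        - z / 6 - 5 / 24) := by
  have h := hasSum_harmonic_mul_baseTerm hz
  rw [← Equiv.pnatEquivNat.hasSum_iff] at h
  convert h using 1
  · funext n
    have hn : ((n : ℕ) : ℂ) = (n.natPred : ℂ) + 1 := by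
      exact_mod_cast n.natPred_add_one.symm
    simp only [Function.comp_apply, Equiv.pnatEquivNat_apply, baseTerm,
      invBinom_eq_inv_complexBinom, PNat.natPred_add_one]
    rw [hn, div_eq_mul_inv, mul_inv, div_eq_mul_inv]
    ring
  · rw [(hasDerivAt_baseClosed hz.1).deriv, baseClosed, complexGenHarmonic, complexGenHarmonic,
      polygamma, polygamma]
    simp [iteratedDeriv_succ]
    ring

lemma complexHarmonic_natCast (n : ℕ) : complexHarmonic n = (harmonic n : ℂ) := by
  have h : (n.factorial : ℂ) ≠ 0 := by exact_mod_cast n.factorial_ne_zero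
  rw [complexHarmonic, Complex.digamma_def, logDeriv_apply, Complex.deriv_Gamma_nat,
    Complex.Gamma_nat_eq_factorial, mul_div_cancel_left₀ _ h]
  ring

lemma zero_mem_seriesDomain : (0 : ℂ) ∈ seriesDomain :=
  ⟨fun k h => Nat.cast_add_one_ne_zero (R := ℂ) k (by linear_combination h), by simp⟩

lemma complexBinom_natCast_self (n : ℕ) : complexBinom n n = 1 := by
  have h : (n.factorial : ℂ) ≠ 0 := by exact_mod_cast n.factorial_ne_zero
  simp [complexBinom, Complex.Gamma_nat_eq_factorial, h]

/-- The case `z = 0`, where `H_0^{(2)} = 0` follows from `ψ'(1) = ζ(2)`. -/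
theorem hasSum_harmonic :
    HasSum
      (fun n : ℕ+ =>
        ((harmonic (n : ℕ) : ℚ) : ℝ) /
          ((n : ℝ) * ((n : ℝ) + 1) * ((n : ℝ) + 2) * ((n : ℝ) + 3)))
      (Real.pi ^ 2 / 36 - 5 / 24) := by
  rw [← Complex.hasSum_ofReal]
  have h := hasSum_complexHarmonic zero_mem_seriesDomain
  convert h using 1
  · funext n
    rw [add_zero, complexBinom_natCast_self, complexHarmonic_natCast]
    push_cast
    rw [mul_one]
  · have h0 : complexHarmonic 0 = 0 := by simpa using complexHarmonic_natCast 0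
    have h2 : complexGenHarmonic 2 0 = 0 := by
      simp [complexGenHarmonic, polygamma, deriv_digamma_one]
    rw [h0, h2, riemannZeta_two]
    push_cast
    ring

end HarmonicSeries

theorem theorem15 :
    (∀ z : ℂ, (∀ k : ℕ, z ≠ -((k : ℂ) + 1)) → -3 < z.re →
      HasSum
        (fun n : ℕ+ =>
          complexHarmonic ((n : ℂ) + z) /
            ((n : ℂ) * ((n : ℂ) + 1) * ((n : ℂ) + 2) * ((n : ℂ) + 3) *
              complexBinom ((n : ℂ) + z) (n : ℂ)))
        ((1 / 12 * z * (z + 1) * (z + 2) * complexHarmonic z - z * (z + 2) / 4 - 1 / 6) *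
            (complexGenHarmonic 2 z - riemannZeta 2)
          + 1 / 6 * z * (z + 1) * (z + 2) * (complexGenHarmonic 3 z - riemannZeta 3)
          + (z ^ 2 / 12 + 5 * z / 24 + 1 / 18) * complexHarmonic z
          - z / 6 - 5 / 24)) ∧
    HasSum
      (fun n : ℕ+ =>
        ((harmonic (n : ℕ) : ℚ) : ℝ) /
          ((n : ℝ) * ((n : ℝ) + 1) * ((n : ℝ) + 2) * ((n : ℝ) + 3)))
      (Real.pi ^ 2 / 36 - 5 / 24) :=
  ⟨fun _ hz hre => HarmonicSeries.hasSum_complexHarmonic ⟨hz, hre⟩,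
    HarmonicSeries.hasSum_harmonic⟩
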